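/- Let $I(n)$ be the graph of the $n$-dimensional hypercube: its vertices are the binary vectors of length $n$, two of them being adjacent if and only if they differ in exactly one position. For a connected graph $G$ let $d_G$ denote the usual graph distance. An $(n,k)$ circuit code is an induced subgraph $C$ of $I(n)$ such that $C$ is a cycle and $d_C(x,x')=d_{I(n)}(x,x')$ for all vertices $x,x'$ of $C$ with $d_{I(n)}(x,x')<k$. Its length is the length of the cycle, and $K(n,k)$ denotes the maximum length of an $(n,k)$ circuit code. Then for every integer $n\ge 6$, $$K(\lfloor 1.53\,n\rfloor,4)\ \ge\ 40\cdot 3^{(n-8)/3},$$ and hence, for every integer $n\ge 6$, $$K(n,4)\ \ge\ 40\cdot 3^{(\lfloor 0.6535\,n\rfloor-8)/3}.$$ Moreover, this last lower bound is larger than the previous non-asymptotic lower bound $6\cdot 2^{\lfloor 2n/6\rfloor-1}$ for $K(n,4)$ whenever $n\ge 86$, that is, $$40\cdot 3^{(\lfloor 0.6535\,n\rfloor-8)/3}\ >\ 6\cdot 2^{\lfloor 2n/6\rfloor-1}\qquad\text{for every integer } n\ge 86 .$$ -/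

import Mathlib

namespace CircuitCode

/-- The graph `I(n)` of the `n`-dimensional hypercube: its vertices are the binary vectors of
length `n`, two of them being adjacent iff they differ in exactly one position. -/
def hypercube (n : ℕ) : SimpleGraph (Fin n → Bool) where
  Adj x y := hammingDist x y = 1
  symm := ⟨fun x y h => by rw [hammingDist_comm]; exact h⟩
  loopless := ⟨fun x h => by simp at h⟩

/-- The subgraph of `I(n)` induced on the vertex set `C` is a circuit code of spread `k` and
length `N`: it is an undirected cycle of length `N ≥ 3`, and any two of its vertices at distance
less than `k` in `I(n)` have the same distance in the cycle.  (The hypercube and the cycle are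
connected, so all graph distances involved are finite.) -/
structure IsCircuitCode (n k N : ℕ) (C : Set (Fin n → Bool)) : Prop where
  three_le : 3 ≤ N
  isCycle : Nonempty ((hypercube n).induce C ≃g SimpleGraph.cycleGraph N)
  spread : ∀ x y : C, (hypercube n).dist (x : Fin n → Bool) (y : Fin n → Bool) < k →
    ((hypercube n).induce C).dist x y = (hypercube n).dist (x : Fin n → Bool) (y : Fin n → Bool)

/-- The set of lengths of `(n, k)` circuit codes. -/
def lengths (n k : ℕ) : Set ℕ := {N | ∃ C : Set (Fin n → Bool), IsCircuitCode n k N C}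

/-- `K n k` is the maximum length of an `(n, k)` circuit code (`0` if there is none). -/
noncomputable def K (n k : ℕ) : ℕ := sSup (lengths n k)

/-- The lengths of `(n, k)` circuit codes are bounded, so the supremum defining `K n k` is the
maximum as soon as there is an `(n, k)` circuit code. -/
theorem bddAbove_lengths (n k : ℕ) : BddAbove (lengths n k) := by
  refine ⟨2 ^ n, ?_⟩
  rintro N ⟨C, hC⟩
  obtain ⟨e⟩ := hC.isCycle
  have h1 : Nat.card C = N := by simpa using Nat.card_congr e.toEquiv
  have h2 : Nat.card C ≤ Nat.card (Fin n → Bool) :=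
    Nat.card_le_card_of_injective _ Subtype.val_injective
  have h3 : Nat.card (Fin n → Bool) = 2 ^ n := by simp
  omega

end CircuitCode

/-!
A circuit code is handled as a periodic sequence `u` of vertices of the cube in which a Hamming
distance `h < k` forces a cyclic distance at most `h` of the indices (`IsSpreadCycle`).

Codes of spread 4 come from codes of spread 3. If `u` is a cycle of spread 3 and length `N`, with
`8 ∣ N`, then inserting a step of a Gray cycle of length `N / 4` in fresh coordinates after every
four steps of `u` gives a cycle of spread 4 and length `5 N / 4` (`IsSpreadCycle.insert`): the
vertices of the Gray cycle are distinct, so it adds the missing unit of distance between blocks.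
This costs about `log₂ (N / 4)` coordinates, which is at most `0.53 n` for `N` near
`32 * 3 ^ ((n - 8) / 3)`.

It remains to find cycles of spread 3 and length about `32 * 3 ^ ((n - 8) / 3)`. Two cycles `u`, `v`
of spread 3 span a torus in the product of their cubes, and a digital line winding around that
torus, with parallel strands at distance at least 3, is again a cycle of spread 3
(`IsSpreadCycle.torus`). Taking for `v` the 4-cycle `I(2)` doubles the length at the cost of 2
dimensions, and a cycle of length 56 in `I(9)` multiplies it by `27 = 3 ^ (9 / 3)` at the cost of 9
dimensions. Together with explicit cycles in dimensions 4, 7, 8 and 9, verified by computation, this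
covers all `n ≥ 6` (`exists_spread_three`).

For `n ≥ 10` the second bound is the first one at `⌊0.6535 n⌋`, because `1.53 * 0.6535 < 1` and
codes in lower dimensions bound `K n 4` from below; the comparison with `6 * 2 ^ (⌊2 n / 6⌋ - 1)` is
elementary arithmetic.
-/

namespace CircuitCode

variable {n m k N : ℕ}

/-! ### Circuit codes as periodic sequences -/

/-- The closed walk `u 0, u 1, …, u (N - 1), u 0` in the hypercube, given as an `N`-periodic
sequence, has spread `k`: two terms at Hamming distance `h < k` have indices at cyclic distance at most
`h` modulo `N`. The cyclic distance is encoded by an integer `x` with `|x| ≤ h` that is congruent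
modulo `N` to the difference of the indices. For `k ≥ 1` the terms of one period are distinct; for
`k = 1` this is all that is demanded. -/
structure IsSpreadCycle (k N : ℕ) (u : ℕ → Fin n → Bool) : Prop where
  periodic : ∀ i, u (i + N) = u i
  step : ∀ i, hammingDist (u i) (u (i + 1)) = 1
  spread : ∀ i j, hammingDist (u i) (u j) < k →
    ∃ x p : ℤ, (j : ℤ) = i + x + p * N ∧ |x| ≤ hammingDist (u i) (u j)

namespace IsSpreadCycle

variable {u : ℕ → Fin n → Bool}

/-- Periodicity of `u`, for indices that are congruent modulo `N` as integers. -/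
theorem eq_of_congr (hu : IsSpreadCycle k N u) {i j : ℕ} {p : ℤ} (h : (j : ℤ) = i + p * N) :
    u j = u i := by
  have hp : Function.Periodic u N := hu.periodic
  have h1 : j % N = i % N := by
    have : (j : ℤ) % N = i % N := by rw [h]; simp
    exact_mod_cast this
  rw [← hp.map_mod_nat j, h1, hp.map_mod_nat]

theorem eq_of_lt (hu : IsSpreadCycle k N u) (hk : 0 < k) {i j : ℕ} (hi : i < N) (hj : j < N)
    (h : u i = u j) : i = j := by
  obtain ⟨x, p, hx, hxle⟩ := hu.spread i j (by rw [h, hammingDist_self]; exact hk)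
  have hx0 : x = 0 := by simpa [h] using hxle
  subst hx0
  have h1 : (j : ℤ) % N = i % N := by rw [hx]; simp
  have h2 : j % N = i % N := by exact_mod_cast h1
  rw [Nat.mod_eq_of_lt hi, Nat.mod_eq_of_lt hj] at h2
  exact h2.symm

end IsSpreadCycle

theorem hammingDist_le_length {x y : Fin n → Bool} (w : (hypercube n).Walk x y) :
    hammingDist x y ≤ w.length := by
  induction w with
  | nil => simp
  | cons h p ih =>
    rename_i a b c
    have h1 : hammingDist a b = 1 := h
    have := hammingDist_triangle a b c
    simp only [SimpleGraph.Walk.length_cons]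
    omega

namespace IsSpreadCycle

variable {u : ℕ → Fin n → Bool}

/-- The stretch of the cycle from `u i` to `u (i + d)`, as a walk in the induced subgraph. -/
theorem exists_walk (hu : IsSpreadCycle k N u) (i d : ℕ) :
    ∃ w : ((hypercube n).induce (Set.range u)).Walk ⟨u i, i, rfl⟩ ⟨u (i + d), i + d, rfl⟩,
      w.length = d := by
  induction d with
  | zero => exact ⟨SimpleGraph.Walk.nil, rfl⟩
  | succ d ih =>
    obtain ⟨w, hw⟩ := ih
    have h : ((hypercube n).induce (Set.range u)).Adj ⟨u (i + d), i + d, rfl⟩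
        ⟨u (i + (d + 1)), i + (d + 1), rfl⟩ := hu.step (i + d)
    exact ⟨w.concat h, by simp [hw]⟩

theorem exists_walk_of_congr (hu : IsSpreadCycle k N u) {i j d : ℕ} {p : ℤ}
    (h : (j : ℤ) = i + d + p * N) :
    ∃ w : ((hypercube n).induce (Set.range u)).Walk ⟨u i, i, rfl⟩ ⟨u j, j, rfl⟩,
      w.length = d := by
  have h1 : u j = u (i + d) := hu.eq_of_congr (p := p) (by push_cast; exact h)
  have h2 : (⟨u j, j, rfl⟩ : Set.range u) = ⟨u (i + d), i + d, rfl⟩ := Subtype.ext h1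
  rw [h2]
  exact hu.exists_walk i d

theorem exists_walk_natAbs (hu : IsSpreadCycle k N u) {i j : ℕ} {x p : ℤ}
    (h : (j : ℤ) = i + x + p * N) :
    ∃ w : ((hypercube n).induce (Set.range u)).Walk ⟨u i, i, rfl⟩ ⟨u j, j, rfl⟩,
      w.length = x.natAbs := by
  rcases le_total 0 x with hx | hx
  · exact hu.exists_walk_of_congr (p := p) (by rw [Int.natAbs_of_nonneg hx]; exact h)
  · obtain ⟨w, hw⟩ := hu.exists_walk_of_congr (i := j) (j := i) (d := x.natAbs) (p := -p) (by
      have : (x.natAbs : ℤ) = -x := by omega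
      rw [this]; linarith)
    exact ⟨w.reverse, by simpa using hw⟩

theorem reachable (hu : IsSpreadCycle k N u) (i j : ℕ) :
    ((hypercube n).induce (Set.range u)).Reachable ⟨u i, i, rfl⟩ ⟨u j, j, rfl⟩ := by
  obtain ⟨w, -⟩ := hu.exists_walk_natAbs (i := i) (j := j) (x := (j : ℤ) - i) (p := 0) (by ring)
  exact w.reachable

/-- For `x = u i` and `y = u j`, an arc of the cycle gives
`d_C x y ≤ hammingDist x y ≤ d_I x y ≤ d_C x y`, the first step when the Hamming distance is less
than `k`. -/
theorem induce_dist_eq (hu : IsSpreadCycle k N u) (x y : Set.range u)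
    (h : (hypercube n).dist (x : Fin n → Bool) y < k) :
    ((hypercube n).induce (Set.range u)).dist x y =
      (hypercube n).dist (x : Fin n → Bool) y := by
  obtain ⟨_, i, rfl⟩ := x
  obtain ⟨_, j, rfl⟩ := y
  obtain ⟨w, hw⟩ := (hu.reachable i j).exists_walk_length_eq_dist
  let f := (SimpleGraph.Embedding.induce (G := hypercube n) (Set.range u)).toHom
  have hle : (hypercube n).dist (u i) (u j) ≤ w.length := by
    have := SimpleGraph.dist_le (w.map f)
    rwa [SimpleGraph.Walk.length_map] at this
  have hr : (hypercube n).Reachable (u i) (u j) := (w.map f).reachable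
  obtain ⟨w', hw'⟩ := hr.exists_walk_length_eq_dist
  have hham := hammingDist_le_length w'
  simp only at h ⊢
  obtain ⟨x, p, hx, hxle⟩ := hu.spread i j (by omega)
  obtain ⟨w'', hw''⟩ := hu.exists_walk_natAbs hx
  have := SimpleGraph.dist_le w''
  rw [Int.abs_eq_natAbs] at hxle
  omega

theorem adj_iff (hu : IsSpreadCycle k N u) (hk : 2 ≤ k) (i j : Fin N) :
    hammingDist (u i) (u j) = 1 ↔ (SimpleGraph.cycleGraph N).Adj i j := by
  have hi := i.isLt
  have hj := j.isLt
  rw [SimpleGraph.cycleGraph_adj', Fin.sub_def, Fin.sub_def]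
  constructor
  · intro h
    obtain ⟨x, p, hx, hxle⟩ := hu.spread i j (by omega)
    rw [h] at hxle
    have hne : (i : ℕ) ≠ j := fun he => by rw [he] at h; simp at h
    have hN : (2 : ℤ) ≤ N := by omega
    have hx' : x = 0 ∨ x = 1 ∨ x = -1 := by
      have := abs_le.mp hxle
      omega
    have hp : p = 0 ∨ p = 1 ∨ p = -1 := by
      have h1 : -2 < p := by
        by_contra hc
        have : p * N ≤ -2 * N := by nlinarith
        omega
      have h2 : p < 2 := by
        by_contra hc
        have : 2 * N ≤ p * N := by nlinarith
        omega
      omega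
    simp only
    have e1 : N - (j : ℕ) + i = (N + i) - j := by omega
    have e2 : N - (i : ℕ) + j = (N + j) - i := by omega
    have key : (N + i - j : ℕ) = N + 1 ∨ (N + i - j : ℕ) = 1 ∨ (N + j - i : ℕ) = N + 1 ∨
        (N + j - i : ℕ) = 1 := by
      rcases hx' with rfl | rfl | rfl <;> rcases hp with rfl | rfl | rfl <;> omega
    have hN1 : (N + 1) % N = 1 := by
      rw [Nat.add_mod_left]; exact Nat.mod_eq_of_lt (by omega)
    have h1N : 1 % N = 1 := Nat.mod_eq_of_lt (by omega)
    rw [e1, e2]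
    rcases key with h | h | h | h <;> simp [h, hN1, h1N]
  · have main : ∀ a b : Fin N, (N - (b : ℕ) + a) % N = 1 → u a = u (b + 1) := by
      intro a b h
      have hb := b.isLt
      have h1 := Nat.div_add_mod (N - (b : ℕ) + a) N
      rw [h] at h1
      refine hu.eq_of_congr (p := ((N - (b : ℕ) + a) / N : ℕ) - 1) ?_
      have h2 : ((N * ((N - (b : ℕ) + a) / N) + 1 : ℕ) : ℤ) = ((N - (b : ℕ) + a : ℕ) : ℤ) := by
        exact_mod_cast h1
      push_cast [hb.le] at h2 ⊢
      linarith
    rintro (h | h)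
    · rw [main i j h, hammingDist_comm]
      exact hu.step j
    · rw [main j i h]
      exact hu.step i

/-- For `k ≥ 2`, the vertices of a cyclic sequence of spread `k` form a circuit code. -/
theorem mem_lengths (hu : IsSpreadCycle k N u) (hk : 2 ≤ k) (hN : 3 ≤ N) :
    N ∈ lengths n k := by
  refine ⟨Set.range u, hN, ⟨?_⟩, hu.induce_dist_eq⟩
  let f : Fin N → Set.range u := fun i => ⟨u i, i, rfl⟩
  have hf : Function.Bijective f := by
    constructor
    · intro i j h
      exact Fin.ext (hu.eq_of_lt (by omega) i.isLt j.isLt (congrArg Subtype.val h))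
    · rintro ⟨_, j, rfl⟩
      refine ⟨⟨j % N, Nat.mod_lt _ (by omega)⟩, Subtype.ext ?_⟩
      exact Function.Periodic.map_mod_nat hu.periodic j
  refine SimpleGraph.Iso.symm ⟨Equiv.ofBijective f hf, ?_⟩
  intro i j
  exact hu.adj_iff hk i j

theorem le_K (hu : IsSpreadCycle k N u) (hk : 2 ≤ k) (hN : 3 ≤ N) : N ≤ K n k :=
  le_csSup (bddAbove_lengths n k) (hu.mem_lengths hk hN)

end IsSpreadCycle

/-! ### Hamming distances of concatenated vectors -/

theorem hammingDist_append (x x' : Fin n → Bool) (y y' : Fin m → Bool) :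
    hammingDist (Fin.append x y) (Fin.append x' y') = hammingDist x x' + hammingDist y y' := by
  simp only [hammingDist, Finset.card_filter]
  rw [Fin.sum_univ_add]
  simp

theorem hammingDist_mod_two (x y z : Fin n → Bool) :
    hammingDist x z % 2 = (hammingDist x y + hammingDist y z) % 2 := by
  simp only [hammingDist, Finset.card_filter]
  rw [← Finset.sum_add_distrib]
  rw [Finset.sum_nat_mod]
  conv_rhs => rw [Finset.sum_nat_mod]
  congr 1
  refine Finset.sum_congr rfl fun i _ => ?_
  cases x i <;> cases y i <;> cases z i <;> rfl

theorem IsSpreadCycle.append {u : ℕ → Fin n → Bool} (hu : IsSpreadCycle k N u) (y : Fin m → Bool) :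
    IsSpreadCycle k N (fun i => Fin.append (u i) y) where
  periodic i := by rw [hu.periodic]
  step i := by rw [hammingDist_append, hu.step, hammingDist_self]
  spread i j h := by
    rw [hammingDist_append, hammingDist_self, add_zero] at h ⊢
    exact hu.spread i j h

/-- A cycle of spread `k` in `I(n)` bounds `K d k` from below for every `d ≥ n`, since it stays a
cycle of spread `k` when constant coordinates are appended. -/
theorem IsSpreadCycle.le_K_of_le {u : ℕ → Fin n → Bool} (hu : IsSpreadCycle k N u) (hk : 2 ≤ k)
    (hN : 3 ≤ N) {d : ℕ} (hd : n ≤ d) : N ≤ K d k := by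
  obtain ⟨e, rfl⟩ := Nat.exists_eq_add_of_le hd
  exact (hu.append (fun _ : Fin e => false)).le_K hk hN

/-! ### A diagonal staircase on the torus spanned by two cycles -/

/-- From cycles of spread 3 and lengths `4 N₁`, `4 M₁`, a cycle of spread 3 and length
`4 N₁ (M₁ + D₁)` in the product of the two cubes. Its `t`-th vertex is the pair
`(u a, v b)` with `b = ⌊t M₁ / (M₁ + D₁)⌋` and `a = t - b`, so `(a, b)` runs through the lattice
points of the strip `0 ≤ M₁ a - D₁ b < M₁ + D₁` (a digital line of slope `M₁ / D₁`). On the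
torus `ℤ / 4 N₁ × ℤ / 4 M₁`, the translates of this strip are separated by multiples of `4 M₁` in
the value of `M₁ a - D₁ b`, which a displacement of length at most 2 cannot bridge because
`D₁ ≤ M₁`. Coprimality of `N₁` and `D₁` makes the strip close up only after it has passed through
all its translates. -/
theorem IsSpreadCycle.torus {N₁ M₁ D₁ : ℕ} {u : ℕ → Fin n → Bool} {v : ℕ → Fin m → Bool}
    (hu : IsSpreadCycle 3 (4 * N₁) u) (hv : IsSpreadCycle 3 (4 * M₁) v)
    (hD : 0 < D₁) (hDM : D₁ ≤ M₁) (hco : Nat.Coprime N₁ D₁) (hN : 0 < N₁) :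
    IsSpreadCycle 3 (N₁ * (4 * M₁ + 4 * D₁)) fun t =>
      Fin.append (u (t - t * M₁ / (M₁ + D₁))) (v (t * M₁ / (M₁ + D₁))) := by
  have hP : 0 < M₁ + D₁ := by omega
  have hble : ∀ t, t * M₁ / (M₁ + D₁) ≤ t := fun t =>
    Nat.div_le_of_le_mul (by nlinarith)
  refine ⟨fun t => ?_, fun t => ?_, fun t t' h => ?_⟩
  · have e : (t + N₁ * (4 * M₁ + 4 * D₁)) * M₁ = t * M₁ + (M₁ + D₁) * (N₁ * (4 * M₁)) := by ring
    rw [e, Nat.add_mul_div_left _ _ hP]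
    congr 1
    · refine hu.eq_of_congr (p := D₁) ?_
      have h1 := hble t
      have h2 : t + N₁ * (4 * M₁ + 4 * D₁) - (t * M₁ / (M₁ + D₁) + N₁ * (4 * M₁)) =
        (t - t * M₁ / (M₁ + D₁)) + D₁ * (4 * N₁) := by
        have : N₁ * (4 * M₁ + 4 * D₁) = N₁ * (4 * M₁) + D₁ * (4 * N₁) := by ring
        omega
      rw [h2]
      push_cast
      ring
    · exact hv.eq_of_congr (p := N₁) (by push_cast; ring)
  · have h1 := hble t
    have h2 := hble (t + 1)
    have h3 : t * M₁ / (M₁ + D₁) ≤ (t + 1) * M₁ / (M₁ + D₁) :=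
      Nat.div_le_div_right (by nlinarith)
    have h4 : (t + 1) * M₁ / (M₁ + D₁) ≤ t * M₁ / (M₁ + D₁) + 1 := by
      rw [← Nat.add_div_right _ hP]
      exact Nat.div_le_div_right (by nlinarith)
    rw [hammingDist_append]
    rcases (by omega : (t + 1) * M₁ / (M₁ + D₁) = t * M₁ / (M₁ + D₁) ∨
      (t + 1) * M₁ / (M₁ + D₁) = t * M₁ / (M₁ + D₁) + 1) with h5 | h5
    · rw [h5, hammingDist_self, Nat.sub_add_comm h1, hu.step]
    · rw [h5, Nat.add_sub_add_right, hammingDist_self, hv.step]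
  · rw [hammingDist_append] at h ⊢
    obtain ⟨x, p, hx, hxle⟩ := hu.spread (t - t * M₁ / (M₁ + D₁)) (t' - t' * M₁ / (M₁ + D₁))
      (by omega)
    obtain ⟨y, q, hy, hyle⟩ := hv.spread (t * M₁ / (M₁ + D₁)) (t' * M₁ / (M₁ + D₁)) (by omega)
    set α := hammingDist (u (t - t * M₁ / (M₁ + D₁))) (u (t' - t' * M₁ / (M₁ + D₁)))
    set β := hammingDist (v (t * M₁ / (M₁ + D₁))) (v (t' * M₁ / (M₁ + D₁)))
    have hb1 := Nat.div_mul_le_self (t * M₁) (M₁ + D₁)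
    have hb2 := Nat.lt_div_mul_add hP (a := t * M₁)
    have hb1' := Nat.div_mul_le_self (t' * M₁) (M₁ + D₁)
    have hb2' := Nat.lt_div_mul_add hP (a := t' * M₁)
    have h1 := hble t
    have h2 := hble t'
    generalize t * M₁ / (M₁ + D₁) = b at *
    generalize t' * M₁ / (M₁ + D₁) = b' at *
    clear_value α β
    obtain ⟨a, rfl⟩ := Nat.exists_eq_add_of_le' h1
    obtain ⟨a', rfl⟩ := Nat.exists_eq_add_of_le' h2
    simp only [Nat.add_sub_cancel] at hx
    zify at hb1 hb2 hb1' hb2' hDM hP hD hN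
    push_cast at hx hy
    have hxy : |x| + |y| ≤ 2 := by omega
    -- `4 M₁ (N₁ p - D₁ q)` is a difference of two values in `[0, M₁ + D₁)`, up to an error of at
    -- most `2 M₁`, hence less than `4 M₁` in absolute value.
    have hcl : (N₁ : ℤ) * p = D₁ * q := by
      have hM : (0 : ℤ) < M₁ := lt_of_lt_of_le hD hDM
      have hlin : 4 * (M₁ : ℤ) * ((N₁ : ℤ) * p - D₁ * q) =
          ((M₁ : ℤ) * a' - D₁ * b') - (M₁ * a - D₁ * b) - (M₁ * x - D₁ * y) := by
        rw [hx, hy]; ring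
      have hxy' : |(M₁ : ℤ) * x - D₁ * y| ≤ 2 * M₁ := by
        calc |(M₁ : ℤ) * x - D₁ * y| ≤ |(M₁ : ℤ) * x| + |(D₁ : ℤ) * y| := abs_sub _ _
          _ = M₁ * |x| + D₁ * |y| := by rw [abs_mul, abs_mul, abs_of_pos hM, abs_of_pos hD]
          _ ≤ M₁ * |x| + M₁ * |y| := by gcongr
          _ = M₁ * (|x| + |y|) := by ring
          _ ≤ M₁ * 2 := by gcongr
          _ = 2 * M₁ := by ring
      rw [abs_le] at hxy'
      have hlo : 4 * (M₁ : ℤ) * (-1) < 4 * M₁ * ((N₁ : ℤ) * p - D₁ * q) := by linarith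
      have hhi : 4 * (M₁ : ℤ) * ((N₁ : ℤ) * p - D₁ * q) < 4 * M₁ * 1 := by linarith
      have h3 := lt_of_mul_lt_mul_left hlo (by linarith)
      have h4 := lt_of_mul_lt_mul_left hhi (by linarith)
      omega
    obtain ⟨r, hr⟩ : (N₁ : ℤ) ∣ q := by
      have hco' : IsCoprime (N₁ : ℤ) D₁ := Nat.isCoprime_iff_coprime.mpr hco
      exact hco'.dvd_of_dvd_mul_left ⟨p, hcl.symm⟩
    have hp : p = D₁ * r := by
      have : (N₁ : ℤ) * p = N₁ * (D₁ * r) := by rw [hcl, hr]; ring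
      exact mul_left_cancel₀ hN.ne' this
    refine ⟨x + y, r, ?_, ?_⟩
    · push_cast
      rw [hx, hy, hp, hr]
      ring
    · have := abs_add_le x y
      push_cast
      linarith

/-! ### Raising the spread from 3 to 4 -/

theorem IsSpreadCycle.hammingDist_mod_two {u : ℕ → Fin n → Bool} (hu : IsSpreadCycle k N u)
    (i j : ℕ) : hammingDist (u i) (u j) % 2 = (i + j) % 2 := by
  have h0 : ∀ i, hammingDist (u 0) (u i) % 2 = i % 2 := by
    intro i
    induction i with
    | zero => simp
    | succ i ih =>
      rw [CircuitCode.hammingDist_mod_two (u 0) (u i), hu.step]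
      omega
  have h1 := CircuitCode.hammingDist_mod_two (u i) (u 0) (u j)
  have h2 := h0 i
  have h3 := h0 j
  rw [hammingDist_comm] at h2
  omega

/-- Inserting a step of a closed cycle `v` of distinct vertices after every four steps of a cycle
`u` of spread 3 gives a cycle of spread 4. Between indices in different blocks of five, the component
in `v` contributes at least 1 to the distance of at least 3 coming from `u`; within a block, `u` itself
attains distance 4 after four steps, because distances in `u` have the parity of the index
difference. -/
theorem IsSpreadCycle.insert {Q : ℕ} {u : ℕ → Fin n → Bool} {v : ℕ → Fin m → Bool}
    (hu : IsSpreadCycle 3 (4 * Q) u) (hv : IsSpreadCycle 1 Q v) (hQ : 2 ≤ Q) :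
    IsSpreadCycle 4 (5 * Q) fun t => Fin.append (u (t - t / 5)) (v (t / 5)) := by
  refine ⟨fun t => ?_, fun t => ?_, fun t t' h => ?_⟩
  · rw [show (t + 5 * Q) / 5 = t / 5 + Q by omega,
      show t + 5 * Q - (t / 5 + Q) = t - t / 5 + 4 * Q by omega, hu.periodic, hv.periodic]
  · rw [hammingDist_append]
    rcases (by omega : (t + 1) / 5 = t / 5 ∨ (t + 1) / 5 = t / 5 + 1) with h5 | h5
    · rw [h5, hammingDist_self, Nat.sub_add_comm (by omega), hu.step]
    · rw [h5, Nat.add_sub_add_right, hammingDist_self, hv.step]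
  · rw [hammingDist_append] at h ⊢
    have hpar := hu.hammingDist_mod_two (t - t / 5) (t' - t' / 5)
    have husp := hu.spread (t - t / 5) (t' - t' / 5)
    have hvsp := hv.spread (t / 5) (t' / 5)
    generalize hammingDist (u (t - t / 5)) (u (t' - t' / 5)) = α at *
    generalize hammingDist (v (t / 5)) (v (t' / 5)) = β at *
    obtain ⟨b, r, hr, rfl⟩ : ∃ b r, r < 5 ∧ t = 5 * b + r :=
      ⟨t / 5, t % 5, Nat.mod_lt _ (by norm_num), (Nat.div_add_mod t 5).symm⟩
    obtain ⟨b', r', hr', rfl⟩ : ∃ b r, r < 5 ∧ t' = 5 * b + r :=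
      ⟨t' / 5, t' % 5, Nat.mod_lt _ (by norm_num), (Nat.div_add_mod t' 5).symm⟩
    have e1 : (5 * b + r) / 5 = b := by omega
    have e2 : (5 * b' + r') / 5 = b' := by omega
    have e3 : 5 * b + r - b = 4 * b + r := by omega
    have e4 : 5 * b' + r' - b' = 4 * b' + r' := by omega
    rw [e1, e2, e3, e4] at hpar husp
    rw [e1, e2] at hvsp
    by_cases hα : α < 3
    · obtain ⟨x, p, hx, hxle⟩ := husp hα
      push_cast at hx ⊢
      have hx' := abs_le.mp hxle
      obtain ⟨e, he⟩ : ∃ e : ℤ, (b' : ℤ) = b + e + p * Q := ⟨b' - b - p * Q, by ring⟩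
      -- `e` is the change of the block index; it is at most 1 in absolute value.
      have he' : 4 * e = r - r' + x := by linarith
      refine ⟨e + x, p, by rw [he] at hx ⊢; linarith, ?_⟩
      by_cases he0 : e = 0
      · rw [he0, zero_add]; omega
      · have hβ : β ≠ 0 := by
          intro hβ
          obtain ⟨y, q, hy, hyle⟩ := hvsp (by omega)
          have hy0 : y = 0 := by simpa [hβ] using hyle
          have hdvd : (Q : ℤ) ∣ e := ⟨q - p, by rw [hy0] at hy; linarith⟩
          have := Int.le_of_dvd (by positivity) ((dvd_abs _ _).mpr hdvd)
          have : |e| ≤ 1 := abs_le.mpr ⟨by omega, by omega⟩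
          omega
        rw [abs_le]
        omega
    · -- Here `α = 3` and `β = 0`, so both indices lie in the same block, and `α` is odd.
      obtain ⟨y, q, hy, hyle⟩ := hvsp (by omega)
      have hy0 : y = 0 := by
        have : β = 0 := by omega
        simpa [this] using hyle
      refine ⟨r' - r, q, by push_cast; rw [hy, hy0]; ring, ?_⟩
      have hpar' : ((r' : ℤ) - r) % 2 = 1 := by
        omega
      rw [abs_le]
      omega

/-! ### Reflected Gray codes -/

/-- The first `c` terms of `p` are distinct and consecutive ones are adjacent in the hypercube. -/
def IsInjPath (c : ℕ) (p : ℕ → Fin n → Bool) : Prop :=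
  (∀ i, i + 1 < c → hammingDist (p i) (p (i + 1)) = 1) ∧ Set.InjOn p (Set.Iio c)

theorem hammingDist_cons (a b : Bool) (x y : Fin n → Bool) :
    hammingDist (Fin.cons a x : Fin (n + 1) → Bool) (Fin.cons b y) =
      (if a = b then 0 else 1) + hammingDist x y := by
  simp only [hammingDist, Finset.card_filter]
  rw [Fin.sum_univ_succ]
  simp

/-- The sequence `p 0, …, p (c - 1), p (c - 1), …, p 0`, with a new first coordinate that is `false`
on the first half and `true` on the second. -/
def fold (c : ℕ) (p : ℕ → Fin n → Bool) (i : ℕ) : Fin (n + 1) → Bool :=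
  if i < c then Fin.cons false (p i) else Fin.cons true (p (2 * c - 1 - i))

theorem IsInjPath.fold {c : ℕ} {p : ℕ → Fin n → Bool} (hp : IsInjPath c p) :
    IsInjPath (2 * c) (fold c p) := by
  refine ⟨fun i hi => ?_, fun i hi j hj h => ?_⟩
  · unfold CircuitCode.fold
    split_ifs with h1 h2 h2
    · rw [hammingDist_cons, hp.1 i h2]; rfl
    · rw [hammingDist_cons, show 2 * c - 1 - (i + 1) = i by omega, hammingDist_self]; rfl
    · omega
    · rw [hammingDist_cons, hammingDist_comm, show 2 * c - 1 - i = 2 * c - 1 - (i + 1) + 1 by omega,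
        hp.1 _ (by omega)]; rfl
  · simp only [Set.mem_Iio] at hi hj
    unfold CircuitCode.fold at h
    split_ifs at h with h1 h2 h2
    · exact hp.2 h1 h2 (Fin.cons_injective2 h).2
    · exact absurd (Fin.cons_injective2 h).1 (by simp)
    · exact absurd (Fin.cons_injective2 h).1 (by simp)
    · have := hp.2 (Set.mem_Iio.mpr (by omega)) (Set.mem_Iio.mpr (by omega))
        (Fin.cons_injective2 h).2
      omega

theorem exists_isInjPath (m : ℕ) : ∃ p : ℕ → Fin m → Bool, IsInjPath (2 ^ m) p := by
  induction m with
  | zero => exact ⟨fun _ _ => false, fun i hi => by simp at hi, fun i hi j hj _ => by simp_all⟩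
  | succ m ih =>
    obtain ⟨p, hp⟩ := ih
    exact ⟨_, by rw [pow_succ']; exact hp.fold⟩

/-- In `I(m + 1)` there are cycles of all even lengths up to `2 ^ (m + 1)`. For `c = 1` it is the
closed walk along an edge and back. -/
theorem exists_gray_cycle {m c : ℕ} (hc : 0 < c) (hcm : c ≤ 2 ^ m) :
    ∃ v : ℕ → Fin (m + 1) → Bool, IsSpreadCycle 1 (2 * c) v := by
  obtain ⟨p, hp⟩ := exists_isInjPath m
  have hp' : IsInjPath c p := ⟨fun i hi => hp.1 i (by omega),
    hp.2.mono (Set.Iio_subset_Iio hcm)⟩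
  refine ⟨fun i => fold c p (i % (2 * c)), fun i => by simp, fun i => ?_, fun i j h => ?_⟩
  · have hlt := Nat.mod_lt i (show 0 < 2 * c by omega)
    by_cases h : i % (2 * c) + 1 < 2 * c
    · rw [Nat.add_mod, Nat.mod_eq_of_lt (show 1 < 2 * c by omega), Nat.mod_eq_of_lt h]
      exact hp'.fold.1 _ h
    · have e : i % (2 * c) = 2 * c - 1 := by omega
      have e' : (i + 1) % (2 * c) = 0 := by
        rw [Nat.add_mod, Nat.mod_eq_of_lt (show 1 < 2 * c by omega), e,
          show 2 * c - 1 + 1 = 2 * c by omega, Nat.mod_self]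
      rw [e, e']
      unfold fold
      rw [if_neg (by omega), if_pos hc, hammingDist_cons, Nat.sub_self, hammingDist_self]
      rfl
  · have h0 : fold c p (i % (2 * c)) = fold c p (j % (2 * c)) := hammingDist_eq_zero.mp (by omega)
    have h1 := hp'.fold.2 (Nat.mod_lt _ (by omega)) (Nat.mod_lt _ (by omega)) h0
    refine ⟨0, (j / (2 * c) : ℕ) - (i / (2 * c) : ℕ), ?_, by simp⟩
    have hi := Nat.div_add_mod i (2 * c)
    have hj := Nat.div_add_mod j (2 * c)
    rw [h1] at hi
    zify at hi hj
    push_cast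
    linarith

/-! ### Cycles given by transition words -/

/-- The vertex reached from the zero vector after `i` steps, step `j` flipping the coordinate
`w[j mod length]`; the vector is stored as the binary digits of a natural number. It is
`length`-periodic in `i` by definition, whether or not the word closes up. -/
def wordVertex (n : ℕ) (w : List ℕ) (i : ℕ) : Fin n → Bool := fun c =>
  ((w.take (i % w.length)).foldl (fun x b => x ^^^ 2 ^ b) 0).testBit c

/-- The finite check that the word `w` is the transition sequence of a cycle of spread `k` in
`I(n)`. The first condition at `i = w.length - 1` says that the word closes up; by symmetry, pairs
`j ≤ i` suffice in the second. -/
def IsSpreadWord (n k : ℕ) (w : List ℕ) : Prop :=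
  ∀ i < w.length, hammingDist (wordVertex n w i) (wordVertex n w (i + 1)) = 1 ∧
    ∀ j ≤ i, hammingDist (wordVertex n w i) (wordVertex n w j) < k →
      i ≤ j + hammingDist (wordVertex n w i) (wordVertex n w j) ∨
        j + w.length ≤ i + hammingDist (wordVertex n w i) (wordVertex n w j)

instance (n k : ℕ) (w : List ℕ) : Decidable (IsSpreadWord n k w) := by
  unfold IsSpreadWord; infer_instance

theorem wordVertex_mod (n : ℕ) (w : List ℕ) (i : ℕ) :
    wordVertex n w (i % w.length) = wordVertex n w i := by
  funext c
  simp [wordVertex]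

theorem IsSpreadWord.isSpreadCycle {w : List ℕ} (hw : IsSpreadWord n k w) (h0 : 0 < w.length) :
    IsSpreadCycle k w.length (wordVertex n w) := by
  refine ⟨fun i => by funext c; simp [wordVertex], fun i => ?_, ?_⟩
  · have h := (hw (i % w.length) (Nat.mod_lt _ h0)).1
    rwa [wordVertex_mod, ← wordVertex_mod n w (i % w.length + 1), Nat.mod_add_mod,
      wordVertex_mod] at h
  · suffices H : ∀ i j, j % w.length ≤ i % w.length →
        hammingDist (wordVertex n w i) (wordVertex n w j) < k →
        ∃ x p : ℤ, (j : ℤ) = i + x + p * w.length ∧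
          |x| ≤ hammingDist (wordVertex n w i) (wordVertex n w j) by
      intro i j h
      rcases le_total (j % w.length) (i % w.length) with hij | hij
      · exact H i j hij h
      · rw [hammingDist_comm] at h ⊢
        obtain ⟨x, p, hx, hxle⟩ := H j i hij h
        exact ⟨-x, -p, by linarith, by rwa [abs_neg]⟩
    intro i j hij h
    have h1 := (hw (i % w.length) (Nat.mod_lt _ h0)).2 (j % w.length) hij
    rw [wordVertex_mod, wordVertex_mod] at h1
    have hi := Nat.div_add_mod i w.length
    have hj := Nat.div_add_mod j w.length
    have hil := Nat.mod_lt i h0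
    have hjl := Nat.mod_lt j h0
    zify at hi hj
    rcases h1 h with h2 | h2
    · refine ⟨(j % w.length : ℕ) - (i % w.length : ℕ),
        (j / w.length : ℕ) - (i / w.length : ℕ), by push_cast; linarith, ?_⟩
      rw [abs_le]; omega
    · refine ⟨(j % w.length : ℕ) - (i % w.length : ℕ) + w.length,
        (j / w.length : ℕ) - (i / w.length : ℕ) - 1, by push_cast; linarith, ?_⟩
      rw [abs_le]; omega

theorem isSpreadWord_two : IsSpreadWord 2 3 [0, 1, 0, 1] := by decide +kernel
theorem isSpreadWord_four : IsSpreadWord 4 3 [0, 1, 2, 3, 0, 1, 2, 3] := by decide +kernel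
theorem isSpreadWord_six_four : IsSpreadWord 6 4 [0, 1, 2, 3, 4, 5, 0, 1, 2, 3, 4, 5] := by
  decide +kernel
theorem isSpreadWord_seven_four : IsSpreadWord 7 4 [0, 1, 2, 3, 4, 5, 6, 0, 1, 2, 3, 4, 5, 6] := by
  decide +kernel
theorem isSpreadWord_seven : IsSpreadWord 7 3
    [1, 4, 2, 3, 6, 4, 1, 5, 2, 4, 6, 0, 1, 4, 2, 3, 6, 4, 1, 5, 2, 4, 6, 0] := by
  decide +kernel
theorem isSpreadWord_eight : IsSpreadWord 8 3
    [1, 7, 2, 6, 0, 4, 1, 6, 2, 3, 0, 5, 6, 1, 4, 0, 6, 2, 1, 7, 5, 6, 0, 4, 1, 6, 5, 3, 0, 2, 6,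
      1, 4, 0, 6, 5] := by
  decide +kernel
theorem isSpreadWord_nine : IsSpreadWord 9 3
    [1, 3, 2, 4, 7, 6, 8, 4, 3, 0, 7, 2, 4, 6, 3, 5, 4, 2, 7, 8, 6, 2, 5, 1, 7, 4, 2, 8, 5, 0, 2,
      4, 7, 6, 8, 4, 0, 3, 7, 2, 4, 6, 0, 1, 4, 2, 7, 8, 6, 2, 1, 5, 7, 4, 2, 8] := by
  decide +kernel

/-! ### Long cycles of spread 3 in every dimension -/

/-- The staircase on the torus with the 4-cycle `I(2)`. -/
theorem exists_double {N₁ : ℕ} (hN : 0 < N₁)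
    (h : ∃ u : ℕ → Fin n → Bool, IsSpreadCycle 3 (4 * N₁) u) :
    ∃ u : ℕ → Fin (n + 2) → Bool, IsSpreadCycle 3 (4 * (2 * N₁)) u := by
  obtain ⟨u, hu⟩ := h
  have hv : IsSpreadCycle 3 (4 * 1) _ := isSpreadWord_two.isSpreadCycle (by decide)
  have H := hu.torus hv (D₁ := 1) one_pos le_rfl (Nat.coprime_one_right N₁) hN
  rw [show N₁ * (4 * 1 + 4 * 1) = 4 * (2 * N₁) by ring] at H
  exact ⟨_, H⟩

/-- The staircase on the torus with a cycle of length 56 in `I(9)`, with `D₁ = 13`: the length is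
multiplied by `14 + 13 = 27`. -/
theorem exists_mul_twentySeven {N₁ : ℕ} (hN : 0 < N₁) (hco : Nat.Coprime N₁ 13)
    (h : ∃ u : ℕ → Fin n → Bool, IsSpreadCycle 3 (4 * N₁) u) :
    ∃ u : ℕ → Fin (n + 9) → Bool, IsSpreadCycle 3 (4 * (27 * N₁)) u := by
  obtain ⟨u, hu⟩ := h
  have hv : IsSpreadCycle 3 (4 * 14) _ := isSpreadWord_nine.isSpreadCycle (by decide)
  have H := hu.torus hv (D₁ := 13) (by norm_num) (by norm_num) hco hN
  rw [show N₁ * (4 * 14 + 4 * 13) = 4 * (27 * N₁) by ring] at H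
  exact ⟨_, H⟩

set_option exponentiation.threshold 1000 in
/-- In `I(n)` there is a cycle of spread 3 and length `N = 8 R` with
`32 * 3 ^ ((n - 8) / 3) ≤ N ≤ 2 ^ (0.53 n + 1)`, both bounds being stated free of roots. The upper
bound keeps the Gray cycle of length `N / 4` within the available dimensions; divisibility by 8
makes that length even, and coprimality to 13 keeps `exists_mul_twentySeven` applicable. -/
theorem exists_spread_three (n : ℕ) (hn : 6 ≤ n) :
    ∃ R : ℕ, 0 < R ∧ Nat.Coprime R 13 ∧ 64 * 3 ^ n ≤ R ^ 3 * 3 ^ 8 ∧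
      2 ^ 200 * R ^ 100 ≤ 2 ^ (53 * n) ∧
      ∃ u : ℕ → Fin n → Bool, IsSpreadCycle 3 (4 * (2 * R)) u := by
  induction n using Nat.strong_induction_on with
  | _ n ih =>
    have c6 : ∃ u : ℕ → Fin 6 → Bool, IsSpreadCycle 3 (4 * (2 * 2)) u :=
      exists_double two_pos ⟨_, isSpreadWord_four.isSpreadCycle (by decide)⟩
    have c7 : ∃ u : ℕ → Fin 7 → Bool, IsSpreadCycle 3 (4 * (2 * 3)) u :=
      ⟨_, isSpreadWord_seven.isSpreadCycle (by decide)⟩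
    have c9 := exists_double (by norm_num) c7
    have c10 : ∃ u : ℕ → Fin 10 → Bool, IsSpreadCycle 3 (4 * (2 * 9)) u :=
      exists_double (by norm_num) ⟨_, isSpreadWord_eight.isSpreadCycle (by decide)⟩
    have c12 := exists_double (by norm_num) c10
    have c11 : ∃ u : ℕ → Fin 11 → Bool, IsSpreadCycle 3 (4 * (2 * 14)) u :=
      exists_double (by norm_num) ⟨_, isSpreadWord_nine.isSpreadCycle (by decide)⟩
    -- The lengths for `n = 6, …, 14` are 16, 24, 32, 48, 72, 96, 144, 224, 288.
    by_cases h15 : n < 15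
    · interval_cases n
      · exact ⟨2, by norm_num, by norm_num, by norm_num, by norm_num, c6⟩
      · exact ⟨3, by norm_num, by norm_num, by norm_num, by norm_num, c7⟩
      · exact ⟨4, by norm_num, by norm_num, by norm_num, by norm_num,
          exists_double (by norm_num) c6⟩
      · exact ⟨6, by norm_num, by norm_num, by norm_num, by norm_num, c9⟩
      · exact ⟨9, by norm_num, by norm_num, by norm_num, by norm_num, c10⟩
      · exact ⟨12, by norm_num, by norm_num, by norm_num, by norm_num,
          exists_double (by norm_num) c9⟩
      · exact ⟨18, by norm_num, by norm_num, by norm_num, by norm_num, c12⟩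
      · exact ⟨28, by norm_num, by norm_num, by norm_num, by norm_num,
          exists_double (by norm_num) c11⟩
      · exact ⟨36, by norm_num, by norm_num, by norm_num, by norm_num,
          exists_double (by norm_num) c12⟩
    · obtain ⟨l, rfl⟩ : ∃ l, n = l + 9 := ⟨n - 9, by omega⟩
      obtain ⟨R, hR, hco, hlo, hup, hu⟩ := ih l (by omega) (by omega)
      refine ⟨27 * R, by omega, Nat.Coprime.mul_left (by norm_num) hco, ?_, ?_, ?_⟩
      · calc 64 * 3 ^ (l + 9) = 27 ^ 3 * (64 * 3 ^ l) := by ring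
          _ ≤ 27 ^ 3 * (R ^ 3 * 3 ^ 8) := Nat.mul_le_mul_left _ hlo
          _ = (27 * R) ^ 3 * 3 ^ 8 := by ring
      · calc 2 ^ 200 * (27 * R) ^ 100 = 27 ^ 100 * (2 ^ 200 * R ^ 100) := by
              rw [mul_pow, mul_left_comm]
          _ ≤ 2 ^ (53 * 9) * 2 ^ (53 * l) := Nat.mul_le_mul (by norm_num) hup
          _ = 2 ^ (53 * (l + 9)) := by rw [← pow_add]; congr 1; ring
      · rw [Nat.mul_left_comm 2 27 R]
        exact exists_mul_twentySeven (by omega) (Nat.Coprime.mul_left (by norm_num) hco) hu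

/-! ### The bounds on `K n 4` -/

/-- The lower bound `L ≥ 40 * 3 ^ ((n - 8) / 3)`, stated without the cube root. The dimension
`n + ⌊53 n / 100⌋` is `⌊1.53 n⌋`. -/
theorem exists_le_K (n : ℕ) (hn : 6 ≤ n) :
    ∃ L : ℕ, 64000 * 3 ^ n ≤ L ^ 3 * 3 ^ 8 ∧ ∀ d, n + 53 * n / 100 ≤ d → L ≤ K d 4 := by
  obtain ⟨R, hR, -, hlo, hup, u, hu⟩ := exists_spread_three n hn
  obtain ⟨m, hm⟩ : ∃ m, 53 * n / 100 = m + 1 := ⟨53 * n / 100 - 1, by omega⟩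
  have hRm : R ≤ 2 ^ m := by
    by_contra! hc
    have h1 : (2 ^ m) ^ 100 < R ^ 100 := Nat.pow_lt_pow_left hc (by norm_num)
    have h2 : 2 ^ (53 * n) ≤ 2 ^ (200 + m * 100) := Nat.pow_le_pow_right two_pos (by omega)
    rw [pow_add, pow_mul 2 m 100] at h2
    have h3 : 2 ^ 200 * (2 ^ m) ^ 100 < 2 ^ 200 * R ^ 100 :=
      Nat.mul_lt_mul_of_pos_left h1 (by positivity)
    omega
  obtain ⟨v, hv⟩ := exists_gray_cycle hR hRm
  refine ⟨5 * (2 * R), by calc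
    64000 * 3 ^ n = 1000 * (64 * 3 ^ n) := by ring
    _ ≤ 1000 * (R ^ 3 * 3 ^ 8) := Nat.mul_le_mul_left _ hlo
    _ = (5 * (2 * R)) ^ 3 * 3 ^ 8 := by ring, fun d hd => ?_⟩
  exact (hu.insert hv (by omega)).le_K_of_le (by norm_num) (by omega) (by omega)

/-- Clears the cube root in the lower bound, so that instances become comparisons of integers. -/
theorem lowerBound_cube (p : ℕ) :
    ((40 : ℝ) * 3 ^ (((p : ℝ) - 8) / 3)) ^ 3 * 3 ^ 8 = 64000 * 3 ^ p := by
  rw [mul_pow, ← Real.rpow_mul_natCast (by norm_num)]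
  rw [show ((p : ℝ) - 8) / 3 * (3 : ℕ) = p - (8 : ℕ) by push_cast; ring,
    Real.rpow_sub (by norm_num), Real.rpow_natCast, Real.rpow_natCast]
  field_simp
  norm_num

theorem lowerBound_le {p L : ℕ} (h : 64000 * 3 ^ p ≤ L ^ 3 * 3 ^ 8) :
    (40 : ℝ) * 3 ^ (((p : ℝ) - 8) / 3) ≤ L := by
  refine le_of_pow_le_pow_left₀ three_ne_zero (by positivity) ?_
  refine le_of_mul_le_mul_right ?_ (show (0 : ℝ) < 3 ^ 8 by positivity)
  rw [lowerBound_cube]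
  exact_mod_cast h

theorem lt_lowerBound {p L : ℕ} (h : L ^ 3 * 3 ^ 8 < 64000 * 3 ^ p) :
    (L : ℝ) < (40 : ℝ) * 3 ^ (((p : ℝ) - 8) / 3) := by
  refine lt_of_pow_lt_pow_left₀ 3 (by positivity) ?_
  refine lt_of_mul_lt_mul_right ?_ (show (0 : ℝ) ≤ 3 ^ 8 by positivity)
  rw [lowerBound_cube]
  exact_mod_cast h

/-- By induction in steps of 11, since `2 ^ 11 < 3 ^ 7` and `7 ≤ 0.6535 * 11`. -/
theorem pow_lt_pow_floor (n : ℕ) (hn : 86 ≤ n) :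
    3 ^ 11 * 2 ^ n < 64000 * 3 ^ (6535 * n / 10000) := by
  induction n using Nat.strong_induction_on with
  | _ n ih =>
    by_cases h : n < 97
    · interval_cases n <;> norm_num
    · obtain ⟨l, rfl⟩ : ∃ l, n = l + 11 := ⟨n - 11, by omega⟩
      calc 3 ^ 11 * 2 ^ (l + 11) = 2 ^ 11 * (3 ^ 11 * 2 ^ l) := by ring
        _ < 2 ^ 11 * (64000 * 3 ^ (6535 * l / 10000)) :=
            Nat.mul_lt_mul_of_pos_left (ih l (by omega) (by omega)) (by positivity)
        _ ≤ 3 ^ 7 * (64000 * 3 ^ (6535 * l / 10000)) := Nat.mul_le_mul_right _ (by norm_num)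
        _ = 64000 * 3 ^ (6535 * l / 10000 + 7) := by ring
        _ ≤ 64000 * 3 ^ (6535 * (l + 11) / 10000) :=
            Nat.mul_le_mul_left _ (Nat.pow_le_pow_right (by norm_num) (by omega))

theorem floor_scale_inv (n : ℕ) : ⌊(0.6535 : ℝ) * (n : ℝ)⌋₊ = 6535 * n / 10000 := by
  rw [← Nat.floor_div_eq_div (K := ℝ)]
  congr 1
  push_cast
  ring

theorem floor_scale_dim (n : ℕ) : ⌊(1.53 : ℝ) * (n : ℝ)⌋₊ = n + 53 * n / 100 := by
  rw [show n + 53 * n / 100 = 153 * n / 100 by omega, ← Nat.floor_div_eq_div (K := ℝ)]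
  congr 1
  push_cast
  ring

theorem le_K_floor (n : ℕ) (hn : 6 ≤ n) :
    (40 : ℝ) * 3 ^ (((n : ℝ) - 8) / 3) ≤ (K ⌊(1.53 : ℝ) * (n : ℝ)⌋₊ 4 : ℝ) := by
  obtain ⟨L, hL, hK⟩ := exists_le_K n hn
  rw [floor_scale_dim]
  exact (lowerBound_le hL).trans (by exact_mod_cast hK _ le_rfl)

theorem floor_le_K (n : ℕ) (hn : 6 ≤ n) :
    (40 : ℝ) * 3 ^ (((⌊(0.6535 : ℝ) * (n : ℝ)⌋₊ : ℝ) - 8) / 3) ≤ (K n 4 : ℝ) := by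
  rw [floor_scale_inv]
  -- For `n < 10` the first bound does not apply, because `⌊0.6535 n⌋ < 6`; cycles of lengths 12 and
  -- 14 in dimensions 6 and 7 suffice.
  by_cases h10 : n < 10
  · have h6 : ∀ d, 6 ≤ d → 12 ≤ K d 4 := fun d hd =>
      (isSpreadWord_six_four.isSpreadCycle (by decide)).le_K_of_le (by norm_num) (by decide) hd
    have h7 : ∀ d, 7 ≤ d → 14 ≤ K d 4 := fun d hd =>
      (isSpreadWord_seven_four.isSpreadCycle (by decide)).le_K_of_le (by norm_num) (by decide) hd
    by_cases hn6 : n = 6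
    · subst hn6
      exact (lowerBound_le (L := 12) (by norm_num)).trans (by exact_mod_cast h6 6 le_rfl)
    · refine (lowerBound_le (L := 14) ?_).trans (by exact_mod_cast h7 n (by omega))
      interval_cases n <;> omega
  · obtain ⟨L, hL, hK⟩ := exists_le_K (6535 * n / 10000) (by omega)
    exact (lowerBound_le hL).trans (by exact_mod_cast hK _ (by omega))

theorem six_mul_two_pow_lt (n : ℕ) (hn : 86 ≤ n) :
    (6 : ℝ) * (2 : ℝ) ^ (⌊(2 * (n : ℝ)) / 6⌋ - 1) <
      (40 : ℝ) * 3 ^ (((⌊(0.6535 : ℝ) * (n : ℝ)⌋₊ : ℝ) - 8) / 3) := by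
  rw [floor_scale_inv]
  have hf : ⌊(2 * (n : ℝ)) / 6⌋ = ((n / 3 : ℕ) : ℤ) := by
    rw [show (2 * (n : ℝ)) / 6 = (n : ℝ) / (3 : ℕ) by push_cast; ring,
      ← Int.natCast_floor_eq_floor (by positivity), Nat.floor_div_eq_div]
  have h6 : (6 : ℝ) * 2 ^ (((n / 3 : ℕ) : ℤ) - 1) = (3 * 2 ^ (n / 3) : ℕ) := by
    rw [zpow_sub₀ two_ne_zero, zpow_natCast]
    push_cast
    ring
  rw [hf, h6]
  refine lt_lowerBound (lt_of_le_of_lt ?_ (pow_lt_pow_floor n hn))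
  calc (3 * 2 ^ (n / 3)) ^ 3 * 3 ^ 8 = 3 ^ 11 * 2 ^ (n / 3 * 3) := by rw [mul_pow, pow_mul]; ring
    _ ≤ 3 ^ 11 * 2 ^ n := Nat.mul_le_mul_left _ (Nat.pow_le_pow_right two_pos (by omega))

end CircuitCode

theorem theorem2 :
    (∀ n : ℕ, 6 ≤ n →
      (40 : ℝ) * (3 : ℝ) ^ (((n : ℝ) - 8) / 3) ≤ (CircuitCode.K ⌊(1.53 : ℝ) * (n : ℝ)⌋₊ 4 : ℝ)) ∧
    (∀ n : ℕ, 6 ≤ n →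
      (40 : ℝ) * (3 : ℝ) ^ (((⌊(0.6535 : ℝ) * (n : ℝ)⌋₊ : ℝ) - 8) / 3) ≤
        (CircuitCode.K n 4 : ℝ)) ∧
    (∀ n : ℕ, 86 ≤ n →
      (6 : ℝ) * (2 : ℝ) ^ (⌊(2 * (n : ℝ)) / 6⌋ - 1) <
        (40 : ℝ) * (3 : ℝ) ^ (((⌊(0.6535 : ℝ) * (n : ℝ)⌋₊ : ℝ) - 8) / 3)) :=
  ⟨CircuitCode.le_K_floor, CircuitCode.floor_le_K, CircuitCode.six_mul_two_pow_lt⟩
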